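/- Let $G$ be a finite simple graph (no loops or multiple edges) with maximum degree $\Delta(G)$. Let $\mathrm{mad}(G)=\max_{H}\frac{2|E(H)|}{|V(H)|}$, the maximum being over all subgraphs $H$ of $G$ with at least one vertex, denote its maximum average degree. Let $\chi'_\ell(G)$ denote its list edge-chromatic number, that is, the least $k$ such that, whenever each edge $e$ of $G$ is given a list $L(e)$ of at least $k$ colors, there is a proper edge-coloring $\varphi$ of $G$ (edges sharing an endpoint get distinct colors) with $\varphi(e)\in L(e)$ for every edge $e$. If $$\mathrm{mad}(G)\le\sqrt{2\Delta(G)}-1,$$ then $\chi'_\ell(G)=\Delta(G)$. -/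

import Mathlib

namespace SimpleGraph

/-- The maximum average degree of a finite graph: the maximum of `2|E(H)| / |V(H)|` over all
subgraphs `H` of `G` having at least one vertex. -/
noncomputable def mad {V : Type*} (G : SimpleGraph V) : ℝ :=
  ⨆ H : {H : G.Subgraph // H.verts.Nonempty},
    2 * (H.1.edgeSet.ncard : ℝ) / (H.1.verts.ncard : ℝ)

/-- For a finite nonempty graph the supremum defining `mad` is a maximum. -/
theorem isGreatest_mad {V : Type*} [Finite V] [Nonempty V] (G : SimpleGraph V) :
    IsGreatest {a : ℝ | ∃ H : G.Subgraph, H.verts.Nonempty ∧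
      a = 2 * (H.edgeSet.ncard : ℝ) / (H.verts.ncard : ℝ)} G.mad := by
  have : Nonempty {H : G.Subgraph // H.verts.Nonempty} :=
    ⟨⟨⊤, by simp [Set.univ_nonempty]⟩⟩
  constructor
  · obtain ⟨H, hH⟩ := exists_eq_ciSup_of_finite
      (f := fun H : {H : G.Subgraph // H.verts.Nonempty} =>
        2 * (H.1.edgeSet.ncard : ℝ) / (H.1.verts.ncard : ℝ))
    exact ⟨H.1, H.2, hH.symm⟩
  · rintro a ⟨H, hne, rfl⟩
    exact le_ciSup (f := fun H : {H : G.Subgraph // H.verts.Nonempty} =>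
        2 * (H.1.edgeSet.ncard : ℝ) / (H.1.verts.ncard : ℝ))
      (Set.finite_range _).bddAbove ⟨H, hne⟩

/-- An edge-coloring is proper if distinct edges with a common endpoint get distinct colors. -/
def IsProperEdgeColoring {V C : Type*} (G : SimpleGraph V) (φ : G.edgeSet → C) : Prop :=
  ∀ e f : G.edgeSet, e ≠ f → (∃ v : V, v ∈ (e : Sym2 V) ∧ v ∈ (f : Sym2 V)) → φ e ≠ φ f

/-- `G` is `L`-edge-colorable: some proper edge-coloring takes the color of each edge from its
list. -/
def ListEdgeColorable {V C : Type*} (G : SimpleGraph V) (L : G.edgeSet → Finset C) : Prop :=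
  ∃ φ : G.edgeSet → C, G.IsProperEdgeColoring φ ∧ ∀ e, φ e ∈ L e

/-- `G` is `k`-edge-choosable: it is `L`-edge-colorable whenever each list has size at least `k`.
Colors are natural numbers; for finite graphs this is no restriction. -/
def EdgeChoosable {V : Type*} (G : SimpleGraph V) (k : ℕ) : Prop :=
  ∀ L : G.edgeSet → Finset ℕ, (∀ e, k ≤ (L e).card) → G.ListEdgeColorable L

/-- The list edge-chromatic number: the least `k` such that `G` is `k`-edge-choosable
(`⊤` if there is none, which does not happen for finite graphs). -/
noncomputable def listEdgeChromaticNumber {V : Type*} (G : SimpleGraph V) : ℕ∞ :=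
  ⨅ k ∈ {k : ℕ | G.EdgeChoosable k}, (k : ℕ∞)

end SimpleGraph

/-! Let D be the maximum degree and s = ⌊√(2D)⌋, so that mad(G) < s and s² ≤ 2D. By induction on
subgraphs H of G, lists of size at least D always suffice, because one of two reductions applies.

(1) An edge uv with d(u) + d(v) ≤ D + 1 is deleted and coloured last.

(2) Let k < s and let A be a nonempty set of vertices of positive degree at most k, each of whose
neighbours has at least k neighbours in A. If (1) does not apply, A is independent. The edges
meeting A are deleted, and afterwards coloured as a bipartite graph with left side A: an edge ending
at v keeps at least |N(v) ∩ A| colours. That is enough by a case of the Borodin–Kostochka–Woodall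
theorem, proved by Galvin's stable matching method (`exists_listColoring_bipartite`).

If neither reduction applies, the failure of (2) bounds the number of vertices of degree at most k
by k - 1 times the number of vertices of degree at least D + 2 - k. Discharging over all k < s then
gives average degree at least s among the nonisolated vertices of H, contradicting mad(G) < s unless
H has no edges.

The lower bound needs only the edges at one vertex. -/

/-! ### Stable matchings and Galvin's method -/

/-- Gale–Shapley by rejections; smaller values of `p` and `q` are preferred. -/
theorem exists_stable_matching {α U W β γ : Type*} [DecidableEq α] [LinearOrder β] [LinearOrder γ]
    (l : α → U) (r : α → W) (p : α → β) (q : α → γ)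
    (hp : ∀ e f, l e = l f → p e = p f → e = f) (hq : ∀ e f, r e = r f → q e = q f → e = f)
    (S : Finset α) :
    ∃ M ⊆ S, (∀ e ∈ M, ∀ f ∈ M, e ≠ f → l e ≠ l f ∧ r e ≠ r f) ∧
      ∀ e ∈ S, e ∉ M → ∃ f ∈ M, (l f = l e ∧ p f < p e) ∨ (r f = r e ∧ q f < q e) := by
  classical
  induction S using Finset.strongInduction with
  | H S ih =>
    -- `T` holds the first choices of the left vertices. If two of them meet on the right, the worse
    -- one, `e`, can be rejected: the better one, `f`, is either matched or dominated, and then only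
    -- on the right, so `e` is dominated too. If no two meet, `T` itself is stable.
    let T := S.filter fun e => ∀ f ∈ S, l f = l e → p e ≤ p f
    by_cases hT : ∃ e ∈ T, ∃ f ∈ T, r f = r e ∧ q f < q e
    · obtain ⟨e, he, f, hf, hr, hlt⟩ := hT
      simp only [T, Finset.mem_filter] at he hf
      have hfe : f ≠ e := by rintro rfl; exact lt_irrefl _ hlt
      obtain ⟨M, hMS, hM, hdom⟩ := ih (S.erase e) (Finset.erase_ssubset he.1)
      refine ⟨M, hMS.trans (Finset.erase_subset _ _), hM, fun x hx hxM => ?_⟩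
      by_cases hxe : x = e
      · subst hxe
        by_cases hfM : f ∈ M
        · exact ⟨f, hfM, Or.inr ⟨hr, hlt⟩⟩
        · obtain ⟨g, hg, h | h⟩ := hdom f (Finset.mem_erase.2 ⟨hfe, hf.1⟩) hfM
          · exact absurd h.2 (not_lt.2 (hf.2 g (Finset.mem_of_mem_erase (hMS hg)) h.1))
          · exact ⟨g, hg, Or.inr ⟨h.1.trans hr, h.2.trans hlt⟩⟩
      · exact hdom x (Finset.mem_erase.2 ⟨hxe, hx⟩) hxM
    · push Not at hT
      refine ⟨T, Finset.filter_subset _ _, fun e he f hf hne => ⟨fun h => ?_, fun h => ?_⟩,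
        fun e he heT => ?_⟩
      · have he' := Finset.mem_filter.1 he
        have hf' := Finset.mem_filter.1 hf
        exact hne (hp e f h (le_antisymm (he'.2 f hf'.1 h.symm) (hf'.2 e he'.1 h)))
      · exact hne (hq e f h (le_antisymm (hT e he f hf h.symm) (hT f hf e he h)))
      · obtain ⟨f, hf, hmin⟩ := Finset.exists_min_image (S.filter fun f => l f = l e) p
          ⟨e, by simp [he]⟩
        simp only [Finset.mem_filter] at hf hmin
        have hfT : f ∈ T := Finset.mem_filter.2
          ⟨hf.1, fun g hg hgl => hmin g ⟨hg, hgl.trans hf.2⟩⟩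
        refine ⟨f, hfT, Or.inl ⟨hf.2, lt_of_le_of_ne (hmin e ⟨he, rfl⟩) fun h => heT ?_⟩⟩
        rwa [← hp f e hf.2 h]

/-- Galvin's argument: preferences on the edges of a bipartite multigraph such that every edge has
fewer preferred neighbours than admissible colors yield a list edge-coloring. -/
theorem exists_listColoring_of_preferences {α U W β γ C : Type*} [DecidableEq α] [DecidableEq U]
    [DecidableEq W] [DecidableEq C] [Nonempty C] [LinearOrder β] [LinearOrder γ]
    (l : α → U) (r : α → W) (p : α → β) (q : α → γ)
    (hp : ∀ e f, l e = l f → p e = p f → e = f) (hq : ∀ e f, r e = r f → q e = q f → e = f)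
    (E : Finset α) (L : α → Finset C)
    (hL : ∀ e ∈ E, (E.filter fun f => l f = l e ∧ p f < p e).card +
      (E.filter fun f => r f = r e ∧ q f < q e).card < (L e).card) :
    ∃ φ : α → C, (∀ e ∈ E, φ e ∈ L e) ∧
      ∀ e ∈ E, ∀ f ∈ E, e ≠ f → (l e = l f ∨ r e = r f) → φ e ≠ φ f := by
  classical
  induction E using Finset.strongInduction generalizing L with
  | H E ih =>
    rcases E.eq_empty_or_nonempty with rfl | ⟨e₀, he₀⟩
    · exact ⟨fun _ => Classical.arbitrary C, by simp, by simp⟩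
    obtain ⟨c, hc⟩ : (L e₀).Nonempty := Finset.card_pos.1 (by have := hL e₀ he₀; omega)
    -- The edges of `M` get colour `c`. Any other edge that loses `c` from its list also loses a
    -- preferred neighbour, so the strict inequality survives.
    obtain ⟨M, hMS, hM, hdom⟩ := exists_stable_matching l r p q hp hq (E.filter fun e => c ∈ L e)
    have hME : M ⊆ E := hMS.trans (Finset.filter_subset _ _)
    have hMne : M.Nonempty := by
      by_contra h
      rw [Finset.not_nonempty_iff_eq_empty] at h
      obtain ⟨f, hf, -⟩ := hdom e₀ (by simp [he₀, hc]) (by simp [h])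
      simp [h] at hf
    obtain ⟨φ, hφL, hφ⟩ := ih (E \ M) (Finset.sdiff_ssubset hME hMne) (fun e => (L e).erase c) (by
      intro e he
      rw [Finset.mem_sdiff] at he
      have h1 := hL e he.1
      have hl : ((E \ M).filter fun f => l f = l e ∧ p f < p e) ⊆
        E.filter fun f => l f = l e ∧ p f < p e :=
        Finset.filter_subset_filter _ Finset.sdiff_subset
      have hr : ((E \ M).filter fun f => r f = r e ∧ q f < q e) ⊆
        E.filter fun f => r f = r e ∧ q f < q e :=
        Finset.filter_subset_filter _ Finset.sdiff_subset
      by_cases hce : c ∈ L e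
      · rw [Finset.card_erase_of_mem hce]
        obtain ⟨f, hf, h | h⟩ := hdom e (by simp [he.1, hce]) he.2
        · have := Finset.card_lt_card (Finset.ssubset_iff_subset_ne.2 ⟨hl, fun heq => by
            have : f ∈ E.filter fun f => l f = l e ∧ p f < p e := by simp [hME hf, h]
            rw [← heq] at this
            simp [hf] at this⟩)
          have := Finset.card_le_card hr
          omega
        · have := Finset.card_lt_card (Finset.ssubset_iff_subset_ne.2 ⟨hr, fun heq => by
            have : f ∈ E.filter fun f => r f = r e ∧ q f < q e := by simp [hME hf, h]
            rw [← heq] at this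
            simp [hf] at this⟩)
          have := Finset.card_le_card hl
          omega
      · rw [Finset.erase_eq_of_notMem hce]
        have := Finset.card_le_card hl
        have := Finset.card_le_card hr
        omega)
    refine ⟨fun e => if e ∈ M then c else φ e, fun e he => ?_, fun e he f hf hne hadj => ?_⟩
    · by_cases heM : e ∈ M
      · simpa [heM] using (Finset.mem_filter.1 (hMS heM)).2
      · simpa [heM] using Finset.mem_of_mem_erase (hφL e (by simp [he, heM]))
    · by_cases heM : e ∈ M <;> by_cases hfM : f ∈ M <;> simp only [heM, hfM, if_true, if_false]
      · have := hM e heM f hfM hne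
        tauto
      · exact (Finset.ne_of_mem_erase (hφL f (by simp [hf, hfM]))).symm
      · exact Finset.ne_of_mem_erase (hφL e (by simp [he, heM]))
      · exact hφ e (by simp [he, heM]) f (by simp [hf, hfM]) hne hadj

/-! ### Labelings and bipartite list colouring -/

/-- Labels for a bipartite multigraph whose left degrees are at most `k` and whose right degrees
are at least `k`: labels are distinct at each right vertex and bounded by its degree, and at most
`j` edges at each left vertex have label less than `j`. -/
theorem exists_labeling {α U W : Type*} [DecidableEq α] [DecidableEq U] [DecidableEq W]
    (l : α → U) (r : α → W) (E : Finset α) (k : ℕ)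
    (hl : ∀ u, (E.filter fun e => l e = u).card ≤ k)
    (hr : ∀ e ∈ E, k ≤ (E.filter fun f => r f = r e).card) :
    ∃ c : α → ℕ, (∀ e ∈ E, c e < (E.filter fun f => r f = r e).card) ∧
      (∀ e ∈ E, ∀ f ∈ E, r e = r f → c e = c f → e = f) ∧
      ∀ u j, (E.filter fun e => l e = u ∧ c e < j).card ≤ j := by
  classical
  induction E using Finset.strongInduction generalizing k with
  | H E ih =>
    rcases E.eq_empty_or_nonempty with rfl | hne
    · exact ⟨fun _ => 0, by simp⟩
    -- At a right vertex of degree d > k, one edge is removed and given the top label d - 1 ≥ k. It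
    -- counts only for j > k, where the left degree bound k already suffices.
    by_cases hbig : ∃ e₀ ∈ E, k < (E.filter fun f => r f = r e₀).card
    · obtain ⟨e₀, he₀, hk⟩ := hbig
      have hfib : ∀ w, ((E.erase e₀).filter fun f => r f = w).card =
          (E.filter fun f => r f = w).card - if r e₀ = w then 1 else 0 := by
        intro w
        rw [Finset.filter_erase]
        split_ifs with h
        · rw [Finset.card_erase_of_mem (by simp [he₀, h])]
        · rw [Finset.erase_eq_of_notMem (by simp [h])]; rfl
      obtain ⟨c, hc1, hc2, hc3⟩ := ih (E.erase e₀) (Finset.erase_ssubset he₀) k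
        (fun u => (Finset.card_le_card
          (Finset.filter_subset_filter _ (Finset.erase_subset _ _))).trans (hl u))
        (fun e he => by
          rw [hfib]
          have := hr e (Finset.mem_of_mem_erase he)
          split_ifs with h
          · rw [← h]; omega
          · omega)
      set d := (E.filter fun f => r f = r e₀).card with hd
      have hlt : ∀ e ∈ E, e ≠ e₀ → r e = r e₀ → c e < d - 1 := by
        intro e he hee h
        have := hc1 e (by simp [he, hee])
        rw [hfib, h, if_pos rfl] at this
        exact this
      refine ⟨Function.update c e₀ (d - 1), fun e he => ?_, fun e he f hf hrr hcc => ?_,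
        fun u j => ?_⟩
      · by_cases h : e = e₀
        · subst h
          simp only [Function.update_self]
          omega
        · rw [Function.update_of_ne h]
          have := hc1 e (by simp [he, h])
          rw [hfib] at this
          omega
      · by_cases h : e = e₀ <;> by_cases h' : f = e₀
        · rw [h, h']
        · subst h
          rw [Function.update_self, Function.update_of_ne h'] at hcc
          have := hlt f hf h' hrr.symm
          omega
        · subst h'
          rw [Function.update_self, Function.update_of_ne h] at hcc
          have := hlt e he h hrr
          omega
        · rw [Function.update_of_ne h, Function.update_of_ne h'] at hcc
          exact hc2 e (by simp [he, h]) f (by simp [hf, h']) hrr hcc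
      · by_cases hj : k ≤ j
        · refine le_trans (Finset.card_le_card fun e he => ?_) ((hl u).trans hj)
          simp only [Finset.mem_filter] at he ⊢
          exact ⟨he.1, he.2.1⟩
        · refine le_trans (Finset.card_le_card fun e he => ?_) (hc3 u j)
          simp only [Finset.mem_filter, Finset.mem_erase] at he ⊢
          by_cases h : e = e₀
          · subst h
            rw [Function.update_self] at he
            omega
          · rw [Function.update_of_ne h] at he
            exact ⟨⟨h, he.1⟩, he.2⟩
    · push Not at hbig
      have hreg : ∀ e ∈ E, (E.filter fun f => r f = r e).card = k := fun e he =>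
        le_antisymm (hbig e he) (hr e he)
      obtain ⟨e₁, he₁⟩ := hne
      have hkpos : 0 < k := by
        rw [← hreg e₁ he₁]
        exact Finset.card_pos.2 ⟨e₁, by simp [he₁]⟩
      let T := (E.image l).filter fun u => (E.filter fun e => l e = u).card = k
      -- Hall's condition for the left vertices of full degree k: a set `s` of them emits k·|s|
      -- edges, and each right vertex absorbs at most k.
      obtain ⟨g, hginj, hg⟩ := (Finset.all_card_le_biUnion_card_iff_exists_injective
        (fun u : T => (E.filter fun e => l e = u).image r)).1 (by
          intro s
          refine Nat.le_of_mul_le_mul_left ?_ hkpos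
          set N := s.biUnion fun u : T => (E.filter fun e => l e = u).image r with hN
          have h1 : (E.filter fun e => ∃ u ∈ s, l e = u).card = k * s.card := by
            rw [mul_comm]
            have : (E.filter fun e => ∃ u ∈ s, l e = u) =
                s.biUnion fun u : T => E.filter fun e => l e = u := by
              ext e; simp [and_comm]
            rw [this, Finset.card_biUnion]
            · rw [Finset.sum_const_nat]
              intro u _
              exact (Finset.mem_filter.1 u.2).2
            · intro u _ v _ huv
              rw [Function.onFun, Finset.disjoint_left]
              intro e he hf
              simp only [Finset.mem_filter] at he hf
              exact huv (Subtype.ext (he.2.symm.trans hf.2))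
          have h2 : (E.filter fun e => r e ∈ N).card ≤ k * N.card := by
            have : (E.filter fun e => r e ∈ N) = N.biUnion fun w => E.filter fun e => r e = w := by
              ext e; simp [and_comm]
            rw [this, mul_comm]
            refine Finset.card_biUnion_le_card_mul _ _ _ fun w hw => ?_
            simp only [hN, Finset.mem_biUnion, Finset.mem_image, Finset.mem_filter] at hw
            obtain ⟨u, hu, e, he, rfl⟩ := hw
            exact hbig e he.1
          rw [← h1]
          refine le_trans (Finset.card_le_card fun e he => ?_) h2
          simp only [Finset.mem_filter] at he ⊢
          obtain ⟨he, u, hu, hlu⟩ := he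
          refine ⟨he, ?_⟩
          simp only [hN, Finset.mem_biUnion, Finset.mem_image, Finset.mem_filter]
          exact ⟨u, hu, e, ⟨he, hlu⟩, rfl⟩)
      -- The matching is extended to one edge at every right vertex. Removing these edges lowers all
      -- right degrees to k - 1 and every full left degree by at least one; they receive the label k
      -- - 1.
      have hx : ∀ w ∈ E.image r, ∃ e ∈ E, r e = w ∧ ∀ u : T, g u = w → l e = u := by
        intro w hw
        by_cases h : ∃ u : T, g u = w
        · obtain ⟨u, rfl⟩ := h
          obtain ⟨e, he, hre⟩ := Finset.mem_image.1 (hg u)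
          rw [Finset.mem_filter] at he
          exact ⟨e, he.1, hre, fun v hv => by rw [hginj hv]; exact he.2⟩
        · obtain ⟨e, he, rfl⟩ := Finset.mem_image.1 hw
          exact ⟨e, he, rfl, fun u hu => absurd ⟨u, hu⟩ h⟩
      have : Nonempty α := ⟨e₁⟩
      choose! x hxE hxr hxl using hx
      let X := (E.image r).image x
      have hXE : X ⊆ E := by
        intro e he
        obtain ⟨w, hw, rfl⟩ := Finset.mem_image.1 he
        exact hxE w hw
      have hXr : ∀ e ∈ X, x (r e) = e := by
        intro e he
        obtain ⟨w, hw, rfl⟩ := Finset.mem_image.1 he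
        rw [hxr w hw]
      have hxX : ∀ e ∈ E, x (r e) ∈ X := fun e he =>
        Finset.mem_image_of_mem _ (Finset.mem_image_of_mem _ he)
      have hfib : ∀ e ∈ E, ((E \ X).filter fun f => r f = r e).card = k - 1 := by
        intro e he
        have hmem : x (r e) ∈ E.filter fun f => r f = r e := by
          simp [hXE (hxX e he), hxr (r e) (Finset.mem_image_of_mem _ he)]
        rw [← hreg e he, ← Finset.card_erase_of_mem hmem]
        congr 1
        ext f
        simp only [Finset.mem_filter, Finset.mem_sdiff, Finset.mem_erase]
        constructor
        · rintro ⟨⟨hf, hfX⟩, hrf⟩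
          refine ⟨?_, hf, hrf⟩
          rintro rfl
          exact hfX (hxX e he)
        · rintro ⟨hne, hf, hrf⟩
          refine ⟨⟨hf, fun hfX => hne ?_⟩, hrf⟩
          rw [← hrf, hXr f hfX]
      obtain ⟨c, hc1, hc2, hc3⟩ := ih (E \ X)
        (Finset.sdiff_ssubset hXE ⟨_, hxX e₁ he₁⟩) (k - 1)
        (fun u => by
          have hsub : ((E \ X).filter fun e => l e = u) ⊆ E.filter fun e => l e = u :=
            Finset.filter_subset_filter _ Finset.sdiff_subset
          by_cases hu : (E.filter fun e => l e = u).card = k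
          · have huT : u ∈ T := by
              refine Finset.mem_filter.2 ⟨?_, hu⟩
              obtain ⟨e, he⟩ := Finset.card_pos.1 (hu ▸ hkpos)
              rw [Finset.mem_filter] at he
              exact Finset.mem_image.2 ⟨e, he⟩
            obtain ⟨e, he, hre⟩ := Finset.mem_image.1 (hg ⟨u, huT⟩)
            rw [Finset.mem_filter] at he
            have hw : g ⟨u, huT⟩ ∈ E.image r := hre ▸ Finset.mem_image_of_mem _ he.1
            have := Finset.card_lt_card (Finset.ssubset_iff_subset_ne.2 ⟨hsub, fun heq => by
              have hm : x (g ⟨u, huT⟩) ∈ E.filter fun e => l e = u := by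
                simp [hxE _ hw, hxl _ hw ⟨u, huT⟩ rfl]
              rw [← heq] at hm
              have hX : x (g ⟨u, huT⟩) ∈ X := Finset.mem_image_of_mem _ hw
              simp [hX] at hm⟩)
            omega
          · have := Finset.card_le_card hsub
            have := hl u
            omega)
        (fun e he => (hfib e (Finset.mem_sdiff.1 he).1).ge)
      have hck : ∀ e ∈ E, e ∉ X → c e < k - 1 := fun e he heX => by
        have := hc1 e (by simp [he, heX])
        rwa [hfib e he] at this
      refine ⟨fun e => if e ∈ X then k - 1 else c e, fun e he => ?_, fun e he f hf hrr hcc => ?_,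
        fun u j => ?_⟩
      · rw [hreg e he]
        dsimp only
        split_ifs with h
        · omega
        · have := hck e he h
          omega
      · by_cases h : e ∈ X <;> by_cases h' : f ∈ X <;> simp only [h, h', if_true, if_false] at hcc
        · rw [← hXr e h, ← hXr f h', hrr]
        · have := hck f hf h'
          omega
        · have := hck e he h
          omega
        · exact hc2 e (by simp [he, h]) f (by simp [hf, h']) hrr hcc
      · by_cases hj : k ≤ j
        · refine le_trans (Finset.card_le_card fun e he => ?_) ((hl u).trans hj)
          simp only [Finset.mem_filter] at he ⊢
          exact ⟨he.1, he.2.1⟩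
        · refine le_trans (Finset.card_le_card fun e he => ?_) (hc3 u j)
          simp only [Finset.mem_filter, Finset.mem_sdiff] at he ⊢
          by_cases h : e ∈ X
          · simp only [h, if_true] at he
            omega
          · simp only [h, if_false] at he
            exact ⟨⟨he.1, h⟩, he.2⟩

/-- A special case of the theorem of Borodin, Kostochka and Woodall on list edge-colorings of
bipartite multigraphs. -/
theorem exists_listColoring_bipartite {α U W C : Type*} [Fintype α] [DecidableEq α] [DecidableEq U]
    [DecidableEq W] [DecidableEq C] [Nonempty C] (l : α → U) (r : α → W) (k : ℕ) (L : α → Finset C)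
    (hl : ∀ u, (Finset.univ.filter fun e => l e = u).card ≤ k)
    (hr : ∀ e, k ≤ (Finset.univ.filter fun f => r f = r e).card)
    (hL : ∀ e, (Finset.univ.filter fun f => r f = r e).card ≤ (L e).card) :
    ∃ φ : α → C, (∀ e, φ e ∈ L e) ∧
      ∀ e f, e ≠ f → (l e = l f ∨ r e = r f) → φ e ≠ φ f := by
  classical
  obtain ⟨c, hc1, hc2, hc3⟩ := exists_labeling l r Finset.univ k hl fun e _ => hr e
  let i := Fintype.equivFin α
  -- Left vertices prefer small labels (ties broken by `i`), right vertices large ones. An edge with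
  -- label c and right degree d then has at most c preferred neighbours on the left and d - 1 - c on
  -- the right.
  obtain ⟨φ, h1, h2⟩ := exists_listColoring_of_preferences l r
    (fun e => toLex (c e, i e)) (fun e => OrderDual.toDual (c e))
    (fun e f _ h => by
      have := congrArg (fun z => (ofLex z).2) h
      exact i.injective this)
    (fun e f hr h => hc2 e (Finset.mem_univ _) f (Finset.mem_univ _) hr h)
    Finset.univ L (by
      intro e _
      refine lt_of_lt_of_le ?_ (hL e)
      have hleft : (Finset.univ.filter fun f => l f = l e ∧
          toLex (c f, i f) < toLex (c e, i e)).card < c e + 1 := by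
        refine lt_of_lt_of_le (Finset.card_lt_card (t := Finset.univ.filter fun f =>
          l f = l e ∧ c f < c e + 1) ?_) (hc3 (l e) (c e + 1))
        refine Finset.ssubset_iff_subset_ne.2 ⟨fun f hf => ?_, fun heq => ?_⟩
        · simp only [Finset.mem_filter, Finset.mem_univ, true_and, Prod.Lex.toLex_lt_toLex] at hf ⊢
          obtain ⟨h, h' | h'⟩ := hf
          · exact ⟨h, by omega⟩
          · exact ⟨h, by omega⟩
        · have : e ∈ Finset.univ.filter fun f => l f = l e ∧ c f < c e + 1 := by simp
          rw [← heq] at this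
          simp at this
      have hright : (Finset.univ.filter fun f => r f = r e ∧
          OrderDual.toDual (c f) < OrderDual.toDual (c e)).card ≤
          (Finset.univ.filter fun f => r f = r e).card - 1 - c e := by
        rw [Nat.sub_sub, add_comm, ← Nat.card_Ico]
        refine Finset.card_le_card_of_injOn c (fun f hf => ?_) fun f hf g hg hfg => ?_
        · simp only [Finset.coe_filter, Finset.mem_univ, true_and, Set.mem_ofPred_eq,
            OrderDual.toDual_lt_toDual] at hf
          have := hc1 f (Finset.mem_univ _)
          rw [hf.1] at this
          simp only [Finset.coe_Ico, Set.mem_Ico]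
          omega
        · simp only [Finset.coe_filter, Finset.mem_univ, true_and, Set.mem_ofPred_eq] at hf hg
          exact hc2 f (Finset.mem_univ _) g (Finset.mem_univ _) (hf.1.trans hg.1.symm) hfg
      have := hc1 e (Finset.mem_univ _)
      omega)
  exact ⟨φ, fun e => h1 e (Finset.mem_univ _),
    fun e f => h2 e (Finset.mem_univ _) f (Finset.mem_univ _)⟩

/-! ### Reducible configurations -/

namespace SimpleGraph

variable {V : Type*}

/-- List edge-colorability with lists and colorings defined on all unordered pairs. -/
def PairListColorable (H : SimpleGraph V) (L : Sym2 V → Finset ℕ) : Prop :=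
  ∃ φ : Sym2 V → ℕ, (∀ u v, H.Adj u v → φ s(u, v) ∈ L s(u, v)) ∧
    ∀ u v w, H.Adj u v → H.Adj u w → v ≠ w → φ s(u, v) ≠ φ s(u, w)

/-- The graph obtained by deleting all edges that meet `A`. -/
def isolate (H : SimpleGraph V) (A : Finset V) : SimpleGraph V where
  Adj u v := H.Adj u v ∧ u ∉ A ∧ v ∉ A
  symm := ⟨fun _ _ h => ⟨h.1.symm, h.2.2, h.2.1⟩⟩
  loopless := ⟨fun _ h => H.loopless.irrefl _ h.1⟩

open Classical in
-- At most D - 1 other edges meet uv, so a colour of its list remains free.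
theorem PairListColorable.of_deleteEdge [Fintype V] {H : SimpleGraph V} {L : Sym2 V → Finset ℕ}
    {D : ℕ} (hL : ∀ e, D ≤ (L e).card) {u v : V} (huv : H.Adj u v)
    (hdeg : H.degree u + H.degree v ≤ D + 1)
    (h : (H.deleteEdges {s(u, v)}).PairListColorable L) : H.PairListColorable L := by
  obtain ⟨φ, hφL, hφ⟩ := h
  simp only [deleteEdges_adj, Set.mem_singleton_iff] at hφL hφ
  let B := ((H.neighborFinset u).erase v).image (fun w => φ s(u, w)) ∪
    ((H.neighborFinset v).erase u).image (fun w => φ s(v, w))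
  have hB : B.card < (L s(u, v)).card := by
    have h1 : ((H.neighborFinset u).erase v).card = H.degree u - 1 :=
      Finset.card_erase_of_mem (by simpa using huv)
    have h2 : ((H.neighborFinset v).erase u).card = H.degree v - 1 :=
      Finset.card_erase_of_mem (by simpa using huv.symm)
    have h3 : B.card ≤ _ := Finset.card_union_le _ _
    have h4 := (Finset.card_image_le (s := (H.neighborFinset u).erase v)
      (f := fun w => φ s(u, w)))
    have h5 := (Finset.card_image_le (s := (H.neighborFinset v).erase u)
      (f := fun w => φ s(v, w)))
    have h6 : 0 < H.degree u := (H.degree_pos_iff_exists_adj u).2 ⟨v, huv⟩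
    have h7 : 0 < H.degree v := (H.degree_pos_iff_exists_adj v).2 ⟨u, huv.symm⟩
    have := hL s(u, v)
    omega
  obtain ⟨c, hcL, hcB⟩ := Finset.exists_mem_notMem_of_card_lt_card hB
  have hcu : ∀ w, H.Adj u w → w ≠ v → φ s(u, w) ≠ c := fun w hw hne heq => hcB <|
    Finset.mem_union_left _ <| Finset.mem_image.2 ⟨w, by simpa using ⟨hne, hw⟩, heq⟩
  have hcv : ∀ w, H.Adj v w → w ≠ u → φ s(v, w) ≠ c := fun w hw hne heq => hcB <|
    Finset.mem_union_right _ <| Finset.mem_image.2 ⟨w, by simpa using ⟨hne, hw⟩, heq⟩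
  have key : ∀ a b b', H.Adj a b → H.Adj a b' → b ≠ b' → s(a, b) = s(u, v) →
      φ s(a, b') ≠ c := by
    intro a b b' _ hb' hne heq
    rcases Sym2.eq_iff.1 heq with ⟨rfl, rfl⟩ | ⟨rfl, rfl⟩
    · exact hcu b' hb' hne.symm
    · exact hcv b' hb' hne.symm
  refine ⟨Function.update φ s(u, v) c, fun a b hab => ?_, fun a b b' hb hb' hne => ?_⟩
  · by_cases he : s(a, b) = s(u, v)
    · rw [he, Function.update_self]
      exact hcL
    · rw [Function.update_of_ne he]
      exact hφL a b ⟨hab, he⟩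
  · have hsne : s(a, b) ≠ s(a, b') := fun h => hne (Sym2.congr_right.1 h)
    by_cases he : s(a, b) = s(u, v)
    · rw [Function.update_of_ne (fun h => hsne (he.trans h.symm)), he, Function.update_self]
      exact (key a b b' hb hb' hne he).symm
    · rw [Function.update_of_ne he]
      by_cases he' : s(a, b') = s(u, v)
      · rw [he', Function.update_self]
        exact key a b' b hb' hb hne.symm he'
      · rw [Function.update_of_ne he']
        exact hφ a b b' ⟨hb, he⟩ ⟨hb', he'⟩ hne

open Classical in
-- At a neighbour v of A, at most D - |N(v) ∩ A| edges are already coloured, so each edge from v to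
-- A keeps at least |N(v) ∩ A| colours, its right degree in the bipartite graph of edges meeting A.
theorem PairListColorable.of_isolate [Fintype V] {H : SimpleGraph V} {L : Sym2 V → Finset ℕ}
    {D k : ℕ} (hL : ∀ e, D ≤ (L e).card) (hD : ∀ v, H.degree v ≤ D) {A : Finset V}
    (hA : ∀ u ∈ A, ∀ v ∈ A, ¬ H.Adj u v) (hk : ∀ u ∈ A, H.degree u ≤ k)
    (hN : ∀ u ∈ A, ∀ v, H.Adj u v → k ≤ (H.neighborFinset v ∩ A).card)
    (h : (H.isolate A).PairListColorable L) : H.PairListColorable L := by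
  obtain ⟨φ, hφL, hφ⟩ := h
  simp only [isolate] at hφL hφ
  let α := {x : V × V // x.1 ∈ A ∧ H.Adj x.1 x.2}
  have hfib : ∀ x : α, (Finset.univ.filter fun y : α => y.1.2 = x.1.2).card =
      (H.neighborFinset x.1.2 ∩ A).card := by
    intro x
    refine Finset.card_bij (fun y _ => y.1.1) (fun y hy => ?_) (fun y hy z hz hyz => ?_)
      fun a ha => ?_
    · simp only [Finset.mem_filter, Finset.mem_univ, true_and] at hy
      simp only [Finset.mem_inter, mem_neighborFinset]
      exact ⟨hy ▸ y.2.2.symm, y.2.1⟩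
    · simp only [Finset.mem_filter, Finset.mem_univ, true_and] at hy hz
      exact Subtype.ext (Prod.ext hyz (hy.trans hz.symm))
    · simp only [Finset.mem_inter, mem_neighborFinset] at ha
      exact ⟨⟨(a, x.1.2), ha.2, ha.1.symm⟩, by simp, rfl⟩
  obtain ⟨ψ, hψL, hψ⟩ := exists_listColoring_bipartite (fun x : α => x.1.1) (fun x : α => x.1.2) k
    (fun x => L s(x.1.1, x.1.2) \ (H.neighborFinset x.1.2 \ A).image fun w => φ s(x.1.2, w))
    (fun u => by
      by_cases hu : u ∈ A
      · refine le_trans ?_ (hk u hu)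
        refine Finset.card_le_card_of_injOn (fun x => x.1.2) (fun x hx => ?_)
          fun x hx y hy hxy => ?_
        · have hx' : x.1.1 = u := by simpa using hx
          have := x.2.2
          rw [hx'] at this
          simpa using this
        · have hx' : x.1.1 = u := by simpa using hx
          have hy' : y.1.1 = u := by simpa using hy
          exact Subtype.ext (Prod.ext (hx'.trans hy'.symm) hxy)
      · rw [Finset.card_eq_zero.2]
        · exact Nat.zero_le _
        · refine Finset.filter_eq_empty_iff.2 fun x _ hx => hu ?_
          rw [← hx]
          exact x.2.1)
    (fun x => (hfib x).symm ▸ hN x.1.1 x.2.1 x.1.2 x.2.2)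
    (fun x => by
      rw [hfib]
      have h1 := Finset.le_card_sdiff
        ((H.neighborFinset x.1.2 \ A).image fun w => φ s(x.1.2, w)) (L s(x.1.1, x.1.2))
      have h2 := Finset.card_image_le (s := H.neighborFinset x.1.2 \ A)
        (f := fun w => φ s(x.1.2, w))
      have h3 := Finset.card_sdiff_add_card_inter (H.neighborFinset x.1.2) A
      have h4 : (H.neighborFinset x.1.2).card ≤ D := hD x.1.2
      have h5 := hL s(x.1.1, x.1.2)
      omega)
  -- Gluing is unambiguous: as `A` is independent, an edge meeting `A` has exactly one end there.
  have hcol : ∃ Φ : Sym2 V → ℕ, (∀ x : α, Φ s(x.1.1, x.1.2) = ψ x) ∧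
      ∀ a b, a ∉ A → b ∉ A → Φ s(a, b) = φ s(a, b) := by
    refine ⟨fun e => if h : ∃ x : α, s(x.1.1, x.1.2) = e then ψ h.choose else φ e,
      fun x => ?_, fun a b ha hb => ?_⟩
    · have hex : ∃ y : α, s(y.1.1, y.1.2) = s(x.1.1, x.1.2) := ⟨x, rfl⟩
      simp only [dif_pos hex]
      congr 1
      rcases Sym2.eq_iff.1 hex.choose_spec with h | h
      · exact Subtype.ext (Prod.ext h.1 h.2)
      · exact absurd x.2.2 (hA _ x.2.1 _ (h.1 ▸ hex.choose.2.1))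
    · refine dif_neg ?_
      rintro ⟨x, hx⟩
      rcases Sym2.eq_iff.1 hx with h | h
      · exact ha (h.1 ▸ x.2.1)
      · exact hb (h.1 ▸ x.2.1)
  obtain ⟨Φ, hΦψ, hΦφ⟩ := hcol
  have hΦ1 : ∀ a b (ha : a ∈ A) (hab : H.Adj a b), Φ s(a, b) = ψ ⟨(a, b), ha, hab⟩ :=
    fun a b ha hab => hΦψ ⟨(a, b), ha, hab⟩
  have hΦ2 : ∀ a b (hb : b ∈ A) (hab : H.Adj a b), Φ s(a, b) = ψ ⟨(b, a), hb, hab.symm⟩ :=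
    fun a b hb hab => by rw [Sym2.eq_swap, hΦ1 b a hb hab.symm]
  have hmix : ∀ a b b', H.Adj a b → H.Adj a b' → b ∈ A → a ∉ A → b' ∉ A →
      Φ s(a, b) ≠ Φ s(a, b') := by
    intro a b b' hb hb' hbA haA hbA' heq
    have := hψL ⟨(b, a), hbA, hb.symm⟩
    rw [← hΦ2 a b hbA hb, heq, hΦφ a b' haA hbA', Finset.mem_sdiff] at this
    exact this.2 (Finset.mem_image.2 ⟨b', by simpa using ⟨hb', hbA'⟩, rfl⟩)
  refine ⟨Φ, fun a b hab => ?_, fun a b b' hb hb' hne => ?_⟩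
  · by_cases ha : a ∈ A
    · rw [hΦ1 a b ha hab]
      exact (Finset.mem_sdiff.1 (hψL ⟨(a, b), ha, hab⟩)).1
    · by_cases hb : b ∈ A
      · rw [hΦ2 a b hb hab, Sym2.eq_swap]
        exact (Finset.mem_sdiff.1 (hψL ⟨(b, a), hb, hab.symm⟩)).1
      · rw [hΦφ a b ha hb]
        exact hφL a b ⟨hab, ha, hb⟩
  · by_cases ha : a ∈ A
    · rw [hΦ1 a b ha hb, hΦ1 a b' ha hb']
      exact hψ _ _ (fun h => hne (congrArg (fun z : α => z.1.2) h)) (Or.inl rfl)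
    · by_cases hbA : b ∈ A <;> by_cases hbA' : b' ∈ A
      · rw [hΦ2 a b hbA hb, hΦ2 a b' hbA' hb']
        exact hψ _ _ (fun h => hne (congrArg (fun z : α => z.1.1) h)) (Or.inr rfl)
      · exact hmix a b b' hb hb' hbA ha hbA'
      · exact (hmix a b' b hb' hb hbA' ha hbA).symm
      · rw [hΦφ a b ha hbA, hΦφ a b' ha hbA']
        exact hφ a b b' ⟨hb, ha, hbA⟩ ⟨hb', ha, hbA'⟩ hne

/-! ### Counting and discharging -/

open Classical in
-- Peeling: removing N(v) from S costs at most k vertices and takes v out of the neighbourhood of S.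
theorem card_le_mul_card_neighbors [Fintype V] (H : SimpleGraph V) (k : ℕ) (S : Finset V)
    (h : ∀ A ⊆ S, A.Nonempty → ∃ u ∈ A, ∃ v, H.Adj u v ∧ (H.neighborFinset v ∩ A).card ≤ k) :
    S.card ≤ k * (S.biUnion fun u => H.neighborFinset u).card := by
  induction S using Finset.strongInduction with
  | H S ih =>
    rcases S.eq_empty_or_nonempty with rfl | hne
    · simp
    obtain ⟨u, hu, v, huv, hv⟩ := h S subset_rfl hne
    have hlt : S \ H.neighborFinset v ⊂ S := by
      refine Finset.ssubset_iff_subset_ne.2 ⟨Finset.sdiff_subset, fun heq => ?_⟩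
      rw [← heq] at hu
      simp [huv.symm] at hu
    have h1 := ih _ hlt fun A hA => h A (hA.trans hlt.1)
    have h2 : ((S \ H.neighborFinset v).biUnion fun u => H.neighborFinset u).card <
        (S.biUnion fun u => H.neighborFinset u).card := by
      refine Finset.card_lt_card (Finset.ssubset_iff_subset_ne.2
        ⟨Finset.biUnion_subset_biUnion_of_subset_left _ hlt.1, fun heq => ?_⟩)
      have hv : v ∈ S.biUnion fun u => H.neighborFinset u :=
        Finset.mem_biUnion.2 ⟨u, hu, by simpa using huv⟩
      rw [← heq] at hv
      simp only [Finset.mem_biUnion, Finset.mem_sdiff, mem_neighborFinset] at hv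
      obtain ⟨a, ha, hav⟩ := hv
      exact ha.2 hav.symm
    have h3 := Finset.card_sdiff_add_card_inter S (H.neighborFinset v)
    rw [Finset.inter_comm] at h3
    have h4 := Nat.mul_le_mul_left k h2
    rw [Nat.mul_succ] at h4
    omega

end SimpleGraph

theorem two_mul_sum_range_ite (x n : ℕ) :
    2 * (∑ k ∈ Finset.range (x + 2 + n), if x + 2 ≤ k then k - 1 else 0) + x * (x + 1) =
      (x + n) * (x + n + 1) := by
  induction n with
  | zero =>
    rw [Finset.sum_eq_zero]
    · ring
    · intro k hk
      rw [Finset.mem_range] at hk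
      exact if_neg (by omega)
  | succ n ih =>
    rw [← add_assoc, Finset.sum_range_succ, if_pos (by omega)]
    have : x + 2 + n - 1 = x + n + 1 := by omega
    rw [this]
    linarith

/-- The balance at a vertex of degree d: it receives 1 for each k in [d, s) and gives k - 1 for each
k < s with d ≥ D + 2 - k. If d < s it gives nothing, since s² ≤ 2D, and ends with exactly s. If d ≥
s, what it gives is a difference of triangular numbers, again controlled by s² ≤ 2D. -/
theorem discharging_inequality {s D d : ℕ} (hs : s * s ≤ 2 * D) (hd : d ≤ D) :
    s + (∑ k ∈ Finset.range s, if D + 2 ≤ d + k then k - 1 else 0) ≤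
      d + ∑ k ∈ Finset.range s, if d ≤ k then 1 else 0 := by
  have hz : ∀ x, D - d = x → (∑ k ∈ Finset.range s, if D + 2 ≤ d + k then k - 1 else 0) =
      ∑ k ∈ Finset.range s, if x + 2 ≤ k then k - 1 else 0 := by
    intro x hx
    refine Finset.sum_congr rfl fun k _ => ?_
    congr 1
    exact propext ⟨fun _ => by omega, fun _ => by omega⟩
  obtain ⟨x, rfl⟩ := Nat.exists_eq_add_of_le hd
  rw [hz x (by omega)]
  rcases lt_or_ge d s with h | h
  · have h1 : (∑ k ∈ Finset.range s, if d ≤ k then 1 else 0) = s - d := by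
      rw [← Finset.sum_filter, ← Finset.card_eq_sum_ones, ← Nat.card_Ico]
      congr 1
      ext k
      simp only [Finset.mem_filter, Finset.mem_range, Finset.mem_Ico]
      omega
    rw [h1, Finset.sum_eq_zero]
    · omega
    · intro k hk
      rw [Finset.mem_range] at hk
      refine if_neg fun hxk => ?_
      nlinarith
  · rcases lt_or_ge s (x + 2) with h2 | h2
    · rw [Finset.sum_eq_zero]
      · omega
      · intro k hk
        rw [Finset.mem_range] at hk
        exact if_neg (by omega)
    · obtain ⟨n, rfl⟩ := Nat.exists_eq_add_of_le h2
      have := two_mul_sum_range_ite x n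
      refine le_add_right ?_
      generalize (∑ k ∈ Finset.range (x + 2 + n), if x + 2 ≤ k then k - 1 else 0) = σ at this ⊢
      nlinarith [Nat.zero_le (x * x)]

namespace SimpleGraph

variable {V : Type*}

open Classical in
-- Isolated vertices, which the reductions create, are left out so that they do not dilute the
-- average.
theorem sum_degree_le_mad_mul_card [Fintype V] {G H : SimpleGraph V} (hHG : H ≤ G) :
    (∑ v with 0 < H.degree v, H.degree v : ℕ) ≤
      G.mad * (Finset.univ.filter fun v => 0 < H.degree v).card := by
  set W := Finset.univ.filter fun v => 0 < H.degree v with hW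
  rcases W.eq_empty_or_nonempty with h | ⟨w, hw⟩
  · simp [h]
  have : Nonempty V := ⟨w⟩
  let K : G.Subgraph :=
    { verts := W
      Adj := H.Adj
      adj_sub := fun h => hHG h
      edge_vert := fun {u v} h => by
        simpa [hW] using (H.degree_pos_iff_exists_adj u).2 ⟨v, h⟩
      symm := H.symm }
  have hKe : K.edgeSet = H.edgeSet := by
    ext e
    induction e with
    | h a b => rfl
  have hle := (isGreatest_mad G).2 ⟨K, ⟨w, hw⟩, rfl⟩
  have hKv : K.verts.ncard = W.card := Set.ncard_coe_finset W
  have hKc : K.edgeSet.ncard = H.edgeFinset.card := by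
    rw [hKe, ← coe_edgeFinset, Set.ncard_coe_finset]
  rw [hKv, hKc, div_le_iff₀ (by exact_mod_cast Finset.card_pos.2 ⟨w, hw⟩)] at hle
  have hsum : ∑ v ∈ W, H.degree v = 2 * H.edgeFinset.card := by
    rw [← H.sum_degrees_eq_twice_card_edges, hW, Finset.sum_filter]
    refine Finset.sum_congr rfl fun v _ => ?_
    split_ifs <;> omega
  rw [hsum]
  exact_mod_cast hle

open Classical in
-- For each k the total received is at most the total given, by peeling: neighbours of vertices of
-- degree at most k have degree at least D + 2 - k. Summing the pointwise balance then gives the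
-- bound.
theorem mul_card_le_sum_degree [Fintype V] {H : SimpleGraph V} {s D : ℕ} (hs : s * s ≤ 2 * D)
    (hD : ∀ v, H.degree v ≤ D) (hedge : ∀ u v, H.Adj u v → D + 2 ≤ H.degree u + H.degree v)
    (hN : ∀ k < s, ∀ A : Finset V, A.Nonempty → (∀ u ∈ A, 0 < H.degree u ∧ H.degree u ≤ k) →
      ∃ u ∈ A, ∃ v, H.Adj u v ∧ (H.neighborFinset v ∩ A).card < k) :
    s * (Finset.univ.filter fun v => 0 < H.degree v).card ≤
      ∑ v with 0 < H.degree v, H.degree v := by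
  set W := Finset.univ.filter fun v => 0 < H.degree v with hW
  have hcount : ∀ k ∈ Finset.range s, (W.filter fun v => H.degree v ≤ k).card ≤
      (k - 1) * (W.filter fun v => D + 2 ≤ H.degree v + k).card := by
    intro k hk
    refine (card_le_mul_card_neighbors H (k - 1) _ fun A hA hne => ?_).trans
      (Nat.mul_le_mul_left _ (Finset.card_le_card fun v hv => ?_))
    · obtain ⟨u, hu, v, huv, h⟩ := hN k (Finset.mem_range.1 hk) A hne fun u hu => by
        simpa [hW] using hA hu
      exact ⟨u, hu, v, huv, by omega⟩
    · simp only [Finset.mem_biUnion, Finset.mem_filter, mem_neighborFinset] at hv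
      obtain ⟨u, ⟨-, hu⟩, huv⟩ := hv
      have := hedge u v huv
      have : 0 < H.degree v := (H.degree_pos_iff_exists_adj v).2 ⟨u, huv.symm⟩
      simp only [hW, Finset.mem_filter, Finset.mem_univ, true_and]
      omega
  have hpoint := Finset.sum_le_sum fun v (_ : v ∈ W) => discharging_inequality hs (hD v)
  rw [Finset.sum_add_distrib, Finset.sum_add_distrib, Finset.sum_const, smul_eq_mul,
    Finset.sum_comm, Finset.sum_comm (s := W)] at hpoint
  have hsum := Finset.sum_le_sum hcount
  have h1 : ∀ k, (∑ v ∈ W, if D + 2 ≤ H.degree v + k then k - 1 else 0) =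
      (k - 1) * (W.filter fun v => D + 2 ≤ H.degree v + k).card := fun k => by
    rw [← Finset.sum_filter, Finset.sum_const, smul_eq_mul, mul_comm]
  have h2 : ∀ k, (∑ v ∈ W, if H.degree v ≤ k then 1 else 0) =
      (W.filter fun v => H.degree v ≤ k).card := fun k => by
    rw [Finset.card_filter]
  simp only [h1, h2] at hpoint
  rw [mul_comm]
  omega

/-! ### The induction and the two bounds -/

open Classical in
theorem PairListColorable.of_mad_le [Fintype V] {G : SimpleGraph V} {D s : ℕ}
    (hs : s * s ≤ 2 * D) (hGD : ∀ v, G.degree v ≤ D) (hmad : G.mad < s) {L : Sym2 V → Finset ℕ}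
    (hL : ∀ e, D ≤ (L e).card) (H : SimpleGraph V) (hHG : H ≤ G) : H.PairListColorable L := by
  induction H using WellFoundedLT.induction with
  | ind H ih =>
    have hD : ∀ v, H.degree v ≤ D := fun v => (degree_le_of_le hHG).trans (hGD v)
    by_cases hedge : ∀ u v, H.Adj u v → D + 2 ≤ H.degree u + H.degree v
    swap
    · push Not at hedge
      obtain ⟨u, v, huv, hlt⟩ := hedge
      refine .of_deleteEdge hL huv (by omega) ?_
      have hle : H.deleteEdges {s(u, v)} ≤ H := deleteEdges_le _
      refine ih _ (lt_of_le_of_ne hle fun heq => ?_) (hle.trans hHG)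
      rw [← heq] at huv
      simp at huv
    by_cases hN : ∀ k < s, ∀ A : Finset V, A.Nonempty →
      (∀ u ∈ A, 0 < H.degree u ∧ H.degree u ≤ k) →
      ∃ u ∈ A, ∃ v, H.Adj u v ∧ (H.neighborFinset v ∩ A).card < k
    swap
    · push Not at hN
      obtain ⟨k, hks, A, ⟨a, ha⟩, hA, hk⟩ := hN
      have hle : H.isolate A ≤ H := fun _ _ h => h.1
      refine .of_isolate hL hD (fun u hu v hv huv => ?_) (fun u hu => (hA u hu).2) hk
        (ih _ (lt_of_le_of_ne hle fun heq => ?_) (hle.trans hHG))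
      -- Adjacent vertices of `A` would give D + 2 ≤ 2k ≤ 2(s - 1), hence s² ≤ 4s - 8, which is
      -- impossible.
      · have h1 := hedge u v huv
        have h2 := (hA u hu).2
        have h3 := (hA v hv).2
        nlinarith
      · obtain ⟨b, hb⟩ := (H.degree_pos_iff_exists_adj a).1 (hA a ha).1
        rw [← heq] at hb
        exact hb.2.1 ha
    have h1 := mul_card_le_sum_degree hs hD hedge hN
    have h2 := sum_degree_le_mad_mul_card hHG
    rcases (Finset.univ.filter fun v => 0 < H.degree v).eq_empty_or_nonempty with h | h
    · have hno : ∀ u v, ¬ H.Adj u v := fun u v huv =>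
        (Finset.filter_eq_empty_iff.1 h) (Finset.mem_univ u)
          ((H.degree_pos_iff_exists_adj u).2 ⟨v, huv⟩)
      exact ⟨fun _ => 0, fun u v huv => absurd huv (hno u v),
        fun u v _ huv => absurd huv (hno u v)⟩
    · have h3 : (0 : ℝ) < (Finset.univ.filter fun v => 0 < H.degree v).card := by
        exact_mod_cast Finset.card_pos.2 h
      have h4 := mul_lt_mul_of_pos_right hmad h3
      have h5 : ((s * (Finset.univ.filter fun v => 0 < H.degree v).card : ℕ) : ℝ) ≤
          (∑ v with 0 < H.degree v, H.degree v : ℕ) := by exact_mod_cast h1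
      rw [Nat.cast_mul] at h5
      linarith

theorem PairListColorable.listEdgeColorable {G : SimpleGraph V} {L : Sym2 V → Finset ℕ}
    (h : G.PairListColorable L) : G.ListEdgeColorable fun e => L e := by
  obtain ⟨φ, hφL, hφ⟩ := h
  refine ⟨fun e => φ e, fun e f hne ⟨v, hve, hvf⟩ => ?_, fun ⟨e, he⟩ => ?_⟩
  · obtain ⟨a, ha⟩ := Sym2.mem_iff_exists.1 hve
    obtain ⟨b, hb⟩ := Sym2.mem_iff_exists.1 hvf
    have hea := e.2
    have hfb := f.2
    rw [ha, mem_edgeSet] at hea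
    rw [hb, mem_edgeSet] at hfb
    dsimp only
    rw [ha, hb]
    refine hφ v a b hea hfb ?_
    rintro rfl
    exact hne (Subtype.ext (ha.trans hb.symm))
  · induction e with
    | h a b => exact hφL a b he

/-- With identical lists of k colours, the edges at any vertex need distinct colours. -/
theorem EdgeChoosable.maxDegree_le [Fintype V] {G : SimpleGraph V} [DecidableRel G.Adj] {k : ℕ}
    (h : G.EdgeChoosable k) : G.maxDegree ≤ k := by
  refine maxDegree_le_of_forall_degree_le _ _ fun v => ?_
  obtain ⟨φ, hφ, hL⟩ := h (fun _ => Finset.range k) fun _ => (Finset.card_range k).ge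
  rw [← card_neighborFinset_eq_degree, ← Finset.card_attach, ← Finset.card_range k]
  refine Finset.card_le_card_of_injOn
    (fun w => φ ⟨s(v, w), (G.mem_neighborFinset v w).1 w.2⟩) (fun w _ => hL _)
    fun w _ w' _ hww => ?_
  by_contra hne
  refine hφ _ _ (fun heq => hne ?_) ⟨v, Sym2.mem_mk_left _ _, Sym2.mem_mk_left _ _⟩ hww
  exact Subtype.ext (Sym2.congr_right.1 (congrArg Subtype.val heq))

theorem edgeChoosable_of_mad_le [Fintype V] {G : SimpleGraph V} [DecidableRel G.Adj]
    (hmad : G.mad ≤ Real.sqrt (2 * (G.maxDegree : ℝ)) - 1) : G.EdgeChoosable G.maxDegree := by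
  classical
  intro L hL
  let M : Sym2 V → Finset ℕ := fun e =>
    if h : e ∈ G.edgeSet then L ⟨e, h⟩ else Finset.range G.maxDegree
  have hM : ∀ e, G.maxDegree ≤ (M e).card := by
    intro e
    by_cases h : e ∈ G.edgeSet
    · simpa [M, h] using hL ⟨e, h⟩
    · simp [M, h]
  -- The -1 in the hypothesis absorbs the rounding of √(2Δ) down to s, giving the strict bound
  -- mad(G) < s.
  have hsqrt : Real.sqrt (2 * (G.maxDegree : ℝ)) < (Nat.sqrt (2 * G.maxDegree) : ℝ) + 1 := by
    have := Real.real_sqrt_lt_nat_sqrt_succ (a := 2 * G.maxDegree)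
    exact_mod_cast this
  have hcol := PairListColorable.of_mad_le (G := G) (Nat.sqrt_le (2 * G.maxDegree))
    (fun v => by convert G.degree_le_maxDegree v) (by linarith) hM G le_rfl
  have := hcol.listEdgeColorable
  have hML : (fun e : G.edgeSet => M e) = L := by
    ext1 e
    simp [M]
  rwa [hML] at this

end SimpleGraph

theorem mainTheorem4 {V : Type*} [Fintype V] (G : SimpleGraph V) [DecidableRel G.Adj]
    (hmad : G.mad ≤ Real.sqrt (2 * (G.maxDegree : ℝ)) - 1) :
    G.listEdgeChromaticNumber = (G.maxDegree : ℕ∞) :=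
  le_antisymm (iInf₂_le G.maxDegree (SimpleGraph.edgeChoosable_of_mad_le hmad))
    (le_iInf₂ fun _ hk => by exact_mod_cast SimpleGraph.EdgeChoosable.maxDegree_le hk)
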